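/- Let $\mathbb{Q}\langle d,j,y\rangle$ be the non-commutative polynomial $\mathbb{Q}$-algebra on three letters $d,j,y$ subject to $dj=jd=1$; write $j^{-k}=d^{k}$ for $k\ge 1$. It has as a basis the reduced words, i.e. the words containing neither $dj$ nor $jd$; these are the words $j^{k_1}yj^{k_2}y\cdots yj^{k_s}$ with $s\ge 1$ and $k_1,\dots,k_s\in\mathbb{Z}$. Define a $\mathbb{Q}$-bilinear product $\sqcup\!\sqcup_0$ on $\mathbb{Q}\langle d,j,y\rangle$ recursively on reduced words by $w\sqcup\!\sqcup_0 1=1\sqcup\!\sqcup_0 w=w$ and $$\begin{aligned} yu\sqcup\!\sqcup_0 v&=y(u\sqcup\!\sqcup_0 v),\qquad u\sqcup\!\sqcup_0 yv=y(u\sqcup\!\sqcup_0 v),\\ ju\sqcup\!\sqcup_0 jv&=j(u\sqcup\!\sqcup_0 jv)+j(ju\sqcup\!\sqcup_0 v),\\ du\sqcup\!\sqcup_0 dv&=d(u\sqcup\!\sqcup_0 dv)-u\sqcup\!\sqcup_0 d^2v,\\ du\sqcup\!\sqcup_0 jv&=d(u\sqcup\!\sqcup_0 jv)-u\sqcup\!\sqcup_0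 v,\\ ju\sqcup\!\sqcup_0 dv&=d(ju\sqcup\!\sqcup_0 v)-u\sqcup\!\sqcup_0 v, \end{aligned}$$ where the words displayed as arguments on the left-hand sides are reduced. Let $\mathcal{T}$ be the linear span of the words $j^{k_1}y\cdots yj^{k_s}$ with $s\ge1$, $k_i\in\mathbb{Z}$ and $k_s\neq 0$. Let $\mathcal{L}$ be the two-sided ideal of the (non-associative) algebra $(\mathbb{Q}\langle d,j,y\rangle,\sqcup\!\sqcup_0)$ generated by the elements $$j^k\bigl(d(u\sqcup\!\sqcup_0 v)-du\sqcup\!\sqcup_0 v-u\sqcup\!\sqcup_0 dv\bigr),$$ where $k\in\mathbb{Z}$ and $u,v$ are reduced words ending in $y$. Let $\mathbb{Q}\langle d,y\rangle\subset\mathbb{Q}\langle d,j,y\rangle$ be the subalgebra generated by $d$ and $y$, which is closed under $\sqcup\!\sqcup_0$, put $\mathcal{T}_-=\mathbb{Q}\langle d,y\rangle\cap\mathcal{T}$ and $\mathcal{L}_-=\mathbb{Q}\langle d,y\rangle\cap\mathcal{L}$, and let $$\mathcal{H}_-=\mathbb{Q}\langle d,y\rangle/(\mathcal{T}_-+\mathcal{L}_-)$$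 with the product induced by $\sqcup\!\sqcup_0$ (the subspace $\mathcal{T}_-+\mathcal{L}_-$ is a two-sided ideal of $(\mathbb{Q}\langle d,y\rangle,\sqcup\!\sqcup_0)$). Then for all integers $r\ge 2$ and $k_1,\dots,k_r\ge 0$ the following identity holds in $\mathcal{H}_-$: $$d^{k_1}y\,d^{k_2}y\cdots d^{k_r}y=\sum_{\substack{i+j=k_1\\ i,j\ge 0}}\binom{k_1}{i}\,\bigl(d^{i}y\bigr)\sqcup\!\sqcup_0\bigl(d^{j}d^{k_2}y\,d^{k_3}y\cdots d^{k_r}y\bigr)$$ (here the summation index $j$ is an integer, not the letter $j$). -/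

import Mathlib

noncomputable section

namespace ShuffleZero

/-! ### Words in `d, j, y` with `dj = jd = 1` -/

/-- A reduced word in the letters `d, j, y`, where `dj = jd = 1`.  With `d = j⁻¹`, every word is
uniquely of the form `j^{k₁} y j^{k₂} y ⋯ y j^{kᵣ}` with `r ≥ 1` and integers `k₁, …, kᵣ`; here
`exp = k₁` and `tail = [k₂, …, kᵣ]`. -/
@[ext] structure Word where
  exp : ℤ
  tail : List ℤ

namespace Word

/-- Concatenation (followed by reduction) of `j^k y j^{a₁} y ⋯` with `w`. -/
def mulAux : ℤ → List ℤ → Word → Word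
  | k, [], w => ⟨k + w.exp, w.tail⟩
  | k, a :: l, w => ⟨k, (mulAux a l w).exp :: (mulAux a l w).tail⟩

instance : Mul Word := ⟨fun u v => mulAux u.exp u.tail v⟩
instance : One Word := ⟨⟨0, []⟩⟩

theorem one_def : (1 : Word) = ⟨0, []⟩ := rfl
theorem mul_nil (k : ℤ) (w : Word) : (⟨k, []⟩ : Word) * w = ⟨k + w.exp, w.tail⟩ := rfl
theorem mul_cons (k a : ℤ) (l : List ℤ) (w : Word) :
    (⟨k, a :: l⟩ : Word) * w =
      ⟨k, ((⟨a, l⟩ : Word) * w).exp :: ((⟨a, l⟩ : Word) * w).tail⟩ := rfl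

theorem exp_mul_assoc (k : ℤ) (u v : Word) :
    (⟨k + u.exp, u.tail⟩ : Word) * v = ⟨k + (u * v).exp, (u * v).tail⟩ := by
  rcases u with ⟨a, _ | ⟨b, l⟩⟩
  · simp [mul_nil, add_assoc]
  · simp [mul_cons]

instance : Monoid Word where
  one_mul w := by simp [one_def, mul_nil]
  mul_one w := by
    rcases w with ⟨k, l⟩
    induction l generalizing k with
    | nil => simp [one_def, mul_nil]
    | cons a l ih => rw [mul_cons, ih]
  mul_assoc u v w := by
    rcases u with ⟨k, l⟩
    induction l generalizing k with
    | nil => rw [mul_nil, mul_nil, exp_mul_assoc]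
    | cons a l ih => rw [mul_cons, mul_cons, mul_cons, ← ih]

/-- The one-letter words `d`, `j` and `y`. -/
def d : Word := ⟨-1, []⟩
def j : Word := ⟨1, []⟩
def y : Word := ⟨0, [0]⟩

theorem d_mul (w : Word) : d * w = ⟨-1 + w.exp, w.tail⟩ := rfl
theorem j_mul (w : Word) : j * w = ⟨1 + w.exp, w.tail⟩ := rfl
theorem y_mul (w : Word) : y * w = ⟨0, w.exp :: w.tail⟩ := by
  simp [y, mul_cons, mul_nil]
theorem d_mul_j : d * j = 1 := rfl
theorem j_mul_d : j * d = 1 := rfl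

/-- The exponent `kᵣ` of `j^{k₁} y ⋯ y j^{kᵣ}`. -/
def lastExp (w : Word) : ℤ := (w.exp :: w.tail).getLast (List.cons_ne_nil _ _)

/-- The words ending in `y`, that is, the words `j^{k₁} y ⋯ j^{kₛ} y` with `s ≥ 1`. -/
def EndsInY (w : Word) : Prop := w.tail ≠ [] ∧ w.lastExp = 0

/-- The number of letters of a reduced word. -/
def length (w : Word) : ℕ := w.exp.natAbs + (w.tail.map fun k => k.natAbs + 1).sum

end Word

/-- The three letters. -/
inductive Letter
  | d | j | y

/-- The first letter of a reduced word and the remaining (reduced) word; `none` for `1`. -/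
def Word.uncons (w : Word) : Option (Letter × Word) :=
  if w.exp < 0 then some (.d, ⟨w.exp + 1, w.tail⟩)
  else if 0 < w.exp then some (.j, ⟨w.exp - 1, w.tail⟩)
  else match w.tail with
    | [] => none
    | a :: l => some (.y, ⟨a, l⟩)

namespace Word

theorem uncons_one : (1 : Word).uncons = none := by simp [uncons, one_def]

theorem uncons_d_mul {w : Word} (h : w.exp ≤ 0) : (d * w).uncons = some (.d, w) := by
  have : -1 + w.exp < 0 := by omega
  simp [uncons, d_mul, this]

theorem uncons_j_mul {w : Word} (h : 0 ≤ w.exp) : (j * w).uncons = some (.j, w) := by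
  have h1 : ¬ (1 + w.exp < 0) := by omega
  have h2 : 0 < 1 + w.exp := by omega
  simp [uncons, j_mul, h1, h2]

theorem uncons_y_mul (w : Word) : (y * w).uncons = some (.y, w) := by
  simp [uncons, y_mul]

theorem eq_one_of_uncons {w : Word} (h : w.uncons = none) : w = 1 := by
  rcases w with ⟨k, _ | ⟨a, l⟩⟩
  · simp only [uncons] at h
    split_ifs at h
    have : k = 0 := by omega
    subst this; rfl
  · simp only [uncons] at h
    split_ifs at h

theorem eq_d_mul_of_uncons {w w' : Word} (h : w.uncons = some (.d, w')) :
    w = d * w' ∧ w'.exp ≤ 0 := by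
  rcases w with ⟨k, _ | ⟨a, l⟩⟩ <;> simp only [uncons] at h <;> split_ifs at h <;>
    simp at h <;> subst h <;> simp [d_mul] <;> omega

theorem eq_j_mul_of_uncons {w w' : Word} (h : w.uncons = some (.j, w')) :
    w = j * w' ∧ 0 ≤ w'.exp := by
  rcases w with ⟨k, _ | ⟨a, l⟩⟩ <;> simp only [uncons] at h <;> split_ifs at h <;>
    simp at h <;> subst h <;> simp [j_mul] <;> omega

theorem eq_y_mul_of_uncons {w w' : Word} (h : w.uncons = some (.y, w')) : w = y * w' := by
  rcases w with ⟨k, _ | ⟨a, l⟩⟩ <;> simp only [uncons] at h <;> split_ifs at h <;>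
    simp at h
  subst h; simp [y_mul]; omega

theorem length_y_mul (w : Word) : (y * w).length = w.length + 1 := by
  simp [length, y_mul]; omega
theorem length_d_mul {w : Word} (h : w.exp ≤ 0) : (d * w).length = w.length + 1 := by
  simp [length, d_mul]; omega
theorem length_j_mul {w : Word} (h : 0 ≤ w.exp) : (j * w).length = w.length + 1 := by
  simp [length, j_mul]; omega

theorem length_of_uncons {w w' : Word} {a : Letter} (h : w.uncons = some (a, w')) :
    w.length = w'.length + 1 := by
  cases a
  · obtain ⟨rfl, h'⟩ := eq_d_mul_of_uncons h; exact length_d_mul h'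
  · obtain ⟨rfl, h'⟩ := eq_j_mul_of_uncons h; exact length_j_mul h'
  · rw [eq_y_mul_of_uncons h]; exact length_y_mul w'

end Word

/-! ### The algebra `ℚ⟨d, j, y⟩` and the product `ш₀` -/

/-- The non-commutative polynomial ring `ℚ⟨d, j, y⟩` with `dj = jd = 1`. -/
abbrev A : Type := MonoidAlgebra ℚ Word

/-- A word, as an element of `ℚ⟨d, j, y⟩`. -/
abbrev A.ofWord (w : Word) : A := MonoidAlgebra.single w 1

abbrev A.d : A := A.ofWord Word.d
abbrev A.j : A := A.ofWord Word.j
abbrev A.y : A := A.ofWord Word.y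

/-- The integral power `j^k`, where `j^{-k} = d^k`. -/
abbrev A.jpow (k : ℤ) : A := A.ofWord ⟨k, []⟩

/-- The product `ш₀` of two reduced words, by recursion. The words `u` and `v` are split as first
letter times remaining reduced word; see `shuffleWord_one_left`, …, `shuffleWord_j_d` below for the
defining equations. -/
def shuffleWord (u v : Word) : A :=
  match _hu : u.uncons, _hv : v.uncons with
  | none, _ => A.ofWord v
  | some _, none => A.ofWord u
  | some (.y, u'), some _ => A.y * shuffleWord u' v
  | some (.d, _), some (.y, v') => A.y * shuffleWord u v'
  | some (.j, _), some (.y, v') => A.y * shuffleWord u v'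
  | some (.j, u'), some (.j, v') => A.j * shuffleWord u' v + A.j * shuffleWord u v'
  | some (.d, u'), some (.d, _) => A.d * shuffleWord u' v - shuffleWord u' (Word.d * v)
  | some (.d, u'), some (.j, v') => A.d * shuffleWord u' v - shuffleWord u' v'
  | some (.j, u'), some (.d, v') => A.d * shuffleWord u v' - shuffleWord u' v'
termination_by (u.length + v.length, u.length)
decreasing_by
  all_goals
    try have h1 := Word.length_of_uncons _hu
    try have h2 := Word.length_of_uncons _hv
    first
    | (apply Prod.Lex.left; omega)
    | (have h3 := Word.eq_d_mul_of_uncons _hv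
       have h4 : (Word.d * v).length = v.length + 1 := Word.length_d_mul (by
         rw [h3.1, Word.d_mul]; have := h3.2; simp; omega)
       rw [Prod.lex_def]; right; simp; omega)

theorem ofWord_mul (u v : Word) : A.ofWord (u * v) = A.ofWord u * A.ofWord v := by
  simp [MonoidAlgebra.single_mul_single]

theorem shuffleWord_one_left (v : Word) : shuffleWord 1 v = A.ofWord v := by
  have h := Word.uncons_one
  rw [shuffleWord]; split <;> simp_all

theorem shuffleWord_one_right (u : Word) : shuffleWord u 1 = A.ofWord u := by
  have h := Word.uncons_one
  rcases h' : u.uncons with _ | ⟨_ | _ | _, w⟩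
  · rw [Word.eq_one_of_uncons h', shuffleWord_one_left]
  all_goals rw [shuffleWord]; split <;> simp_all

theorem shuffleWord_y_left (u v : Word) :
    shuffleWord (Word.y * u) v = A.y * shuffleWord u v := by
  have h := Word.uncons_y_mul u
  rcases h' : v.uncons with _ | ⟨_ | _ | _, w⟩
  · rw [Word.eq_one_of_uncons h', shuffleWord_one_right, shuffleWord_one_right, ofWord_mul]
  all_goals rw [shuffleWord]; split <;> simp_all

theorem shuffleWord_y_right (u v : Word) :
    shuffleWord u (Word.y * v) = A.y * shuffleWord u v := by
  have h' := Word.uncons_y_mul v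
  induction hn : u.length generalizing u with
  | zero =>
    have : u.uncons = none := by
      rcases h : u.uncons with _ | ⟨a, w⟩
      · rfl
      · have := Word.length_of_uncons h; omega
    rw [Word.eq_one_of_uncons this, shuffleWord_one_left, shuffleWord_one_left, ofWord_mul]
  | succ n ih =>
    rcases h : u.uncons with _ | ⟨_ | _ | _, w⟩
    · rw [Word.eq_one_of_uncons h, shuffleWord_one_left, shuffleWord_one_left, ofWord_mul]
    · clear ih
      rw [shuffleWord]; split <;> simp_all
    · clear ih
      rw [shuffleWord]; split <;> simp_all
    · have := Word.length_of_uncons h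
      rw [Word.eq_y_mul_of_uncons h, shuffleWord_y_left, shuffleWord_y_left,
        ih _ (by omega)]

theorem shuffleWord_j_j {u v : Word} (hu : 0 ≤ u.exp) (hv : 0 ≤ v.exp) :
    shuffleWord (Word.j * u) (Word.j * v) =
      A.j * shuffleWord u (Word.j * v) + A.j * shuffleWord (Word.j * u) v := by
  have h := Word.uncons_j_mul hu
  have h' := Word.uncons_j_mul hv
  rw [shuffleWord]; split <;> simp_all

theorem shuffleWord_d_d {u v : Word} (hu : u.exp ≤ 0) (hv : v.exp ≤ 0) :
    shuffleWord (Word.d * u) (Word.d * v) =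
      A.d * shuffleWord u (Word.d * v) - shuffleWord u (Word.d * (Word.d * v)) := by
  have h := Word.uncons_d_mul hu
  have h' := Word.uncons_d_mul hv
  rw [shuffleWord]; split <;> simp_all

theorem shuffleWord_d_j {u v : Word} (hu : u.exp ≤ 0) (hv : 0 ≤ v.exp) :
    shuffleWord (Word.d * u) (Word.j * v) =
      A.d * shuffleWord u (Word.j * v) - shuffleWord u v := by
  have h := Word.uncons_d_mul hu
  have h' := Word.uncons_j_mul hv
  rw [shuffleWord]; split <;> simp_all

theorem shuffleWord_j_d {u v : Word} (hu : 0 ≤ u.exp) (hv : v.exp ≤ 0) :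
    shuffleWord (Word.j * u) (Word.d * v) =
      A.d * shuffleWord (Word.j * u) v - shuffleWord u v := by
  have h := Word.uncons_j_mul hu
  have h' := Word.uncons_d_mul hv
  rw [shuffleWord]; split <;> simp_all

/-- The product `ш₀` on `ℚ⟨d, j, y⟩`, extended bilinearly from words. -/
def shuffle : A →ₗ[ℚ] A →ₗ[ℚ] A :=
  (MonoidAlgebra.basis Word ℚ).constr ℚ fun u =>
    (MonoidAlgebra.basis Word ℚ).constr ℚ fun v => shuffleWord u v

theorem shuffle_ofWord (u v : Word) : shuffle (A.ofWord u) (A.ofWord v) = shuffleWord u v := by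
  have h (w : Word) : A.ofWord w = MonoidAlgebra.basis Word ℚ w := by simp
  rw [h u, h v, shuffle, Module.Basis.constr_basis, Module.Basis.constr_basis]

/-! ### The subspaces `𝒯`, `ℒ` -/

/-- `𝒯`: the span of the words `j^{k₁} y ⋯ y j^{kᵣ}` with `kᵣ ≠ 0`. -/
def T : Submodule ℚ A := Submodule.span ℚ (A.ofWord '' {w | w.lastExp ≠ 0})

/-- Two-sided ideals of the non-associative algebra `(ℚ⟨d, j, y⟩, ш₀)`. -/
def IsShuffleIdeal (I : Submodule ℚ A) : Prop :=
  ∀ a : A, ∀ x ∈ I, shuffle a x ∈ I ∧ shuffle x a ∈ I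

/-- The two-sided ideal of `(ℚ⟨d, j, y⟩, ш₀)` generated by a set. -/
def shuffleIdealSpan (S : Set A) : Submodule ℚ A := sInf {I | IsShuffleIdeal I ∧ S ⊆ I}

/-- The elements `j^k (d(u ш₀ v) - du ш₀ v - u ш₀ dv)`, for `k ∈ ℤ` and words `u, v` ending
in `y`. -/
def leibnizElements : Set A :=
  {x | ∃ (k : ℤ) (u v : Word), u.EndsInY ∧ v.EndsInY ∧
    x = A.jpow k * (A.d * shuffle (A.ofWord u) (A.ofWord v)
      - shuffle (A.d * A.ofWord u) (A.ofWord v) - shuffle (A.ofWord u) (A.d * A.ofWord v))}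

/-- `ℒ`: the two-sided ideal generated by the `leibnizElements`. -/
def L : Submodule ℚ A := shuffleIdealSpan leibnizElements

theorem isShuffleIdeal_L : IsShuffleIdeal L := fun a x hx =>
  ⟨Submodule.mem_sInf.2 fun I hI => (hI.1 a x (Submodule.mem_sInf.1 hx I hI)).1,
   Submodule.mem_sInf.2 fun I hI => (hI.1 a x (Submodule.mem_sInf.1 hx I hI)).2⟩

/-! ### The subalgebra `ℚ⟨d, y⟩` -/

/-- The subalgebra `ℚ⟨d, y⟩` of `ℚ⟨d, j, y⟩` generated by `d` and `y`. -/
def Qdy : Subalgebra ℚ A := Algebra.adjoin ℚ {A.d, A.y}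

/-- The words in `d, y`. -/
def Word.IsDY (w : Word) : Prop := w.exp ≤ 0 ∧ ∀ k ∈ w.tail, k ≤ 0

theorem Word.IsDY.mul {u v : Word} (hu : u.IsDY) (hv : v.IsDY) : (u * v).IsDY := by
  rcases u with ⟨k, l⟩
  induction l generalizing k with
  | nil =>
    rw [Word.mul_nil]
    have h1 := hu.1
    have h2 := hv.1
    exact ⟨by simp at h1 ⊢; omega, hv.2⟩
  | cons a l ih =>
    rw [Word.mul_cons]
    have := ih a ⟨hu.2 a (by simp), fun k hk => hu.2 k (List.mem_cons_of_mem _ hk)⟩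
    refine ⟨hu.1, fun b hb => ?_⟩
    rcases List.mem_cons.1 hb with rfl | hb
    · exact this.1
    · exact this.2 b hb

theorem Word.isDY_d : Word.d.IsDY := by simp [Word.IsDY, Word.d]
theorem Word.isDY_y : Word.y.IsDY := by simp [Word.IsDY, Word.y]

/-- Induction for words in `d, y`. -/
theorem Word.IsDY.induction {P : Word → Prop} (one : P 1)
    (d : ∀ w, w.IsDY → P w → P (Word.d * w)) (y : ∀ w, w.IsDY → P w → P (Word.y * w))
    {w : Word} (hw : w.IsDY) : P w := by
  induction hn : w.length generalizing w with
  | zero =>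
    have : w.uncons = none := by
      rcases h : w.uncons with _ | ⟨a, w⟩
      · rfl
      · have := Word.length_of_uncons h; omega
    rwa [Word.eq_one_of_uncons this]
  | succ n ih =>
    rcases h : w.uncons with _ | ⟨_ | _ | _, w'⟩
    · rwa [Word.eq_one_of_uncons h]
    · have hl := Word.length_of_uncons h
      obtain ⟨rfl, h'⟩ := Word.eq_d_mul_of_uncons h
      have : w'.IsDY := ⟨h', hw.2⟩
      exact d _ this (ih this (by omega))
    · obtain ⟨rfl, h'⟩ := Word.eq_j_mul_of_uncons h
      have := hw.1
      simp [Word.j_mul] at this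
      omega
    · have hl := Word.length_of_uncons h
      obtain rfl := Word.eq_y_mul_of_uncons h
      have : w'.IsDY := by
        rw [Word.y_mul] at hw
        exact ⟨hw.2 _ (by simp), fun k hk => hw.2 k (List.mem_cons_of_mem _ hk)⟩
      exact y _ this (ih this (by omega))

theorem ofWord_mem_Qdy {w : Word} (hw : w.IsDY) : A.ofWord w ∈ Qdy := by
  refine hw.induction (P := fun w => A.ofWord w ∈ Qdy) Qdy.one_mem ?_ ?_
  · intro w _ h
    rw [ofWord_mul]
    exact Qdy.mul_mem (Algebra.subset_adjoin (by simp)) h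
  · intro w _ h
    rw [ofWord_mul]
    exact Qdy.mul_mem (Algebra.subset_adjoin (by simp)) h

theorem mem_Qdy_iff {x : A} :
    x ∈ Qdy ↔ x ∈ Submodule.span ℚ (A.ofWord '' {w | w.IsDY}) := by
  constructor
  · intro hx
    have hmul (a b : A) (ha : a ∈ Submodule.span ℚ (A.ofWord '' {w | w.IsDY}))
        (hb : b ∈ Submodule.span ℚ (A.ofWord '' {w | w.IsDY})) :
        a * b ∈ Submodule.span ℚ (A.ofWord '' {w | w.IsDY}) := by
      have := Submodule.mul_mem_mul ha hb
      rw [Submodule.span_mul_span] at this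
      refine Submodule.span_mono ?_ this
      rintro _ ⟨_, ⟨u, hu, rfl⟩, _, ⟨v, hv, rfl⟩, rfl⟩
      exact ⟨u * v, hu.mul hv, ofWord_mul u v⟩
    have hone : (1 : A) ∈ Submodule.span ℚ (A.ofWord '' {w | w.IsDY}) :=
      Submodule.subset_span ⟨1, by simp [Word.IsDY, Word.one_def], rfl⟩
    induction hx using Algebra.adjoin_induction with
    | mem x hx =>
      rcases hx with rfl | rfl
      · exact Submodule.subset_span ⟨_, Word.isDY_d, rfl⟩
      · exact Submodule.subset_span ⟨_, Word.isDY_y, rfl⟩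
    | algebraMap r =>
      rw [Algebra.algebraMap_eq_smul_one]
      exact Submodule.smul_mem _ _ hone
    | add a b _ _ ha hb => exact Submodule.add_mem _ ha hb
    | mul a b _ _ ha hb => exact hmul a b ha hb
  · intro hx
    refine (Submodule.span_le (p := Subalgebra.toSubmodule Qdy)).2 ?_ hx
    rintro _ ⟨w, hw, rfl⟩
    exact ofWord_mem_Qdy hw

theorem mem_Qdy_inf_T_iff {x : A} :
    x ∈ Qdy ∧ x ∈ T ↔
      x ∈ Submodule.span ℚ (A.ofWord '' {w | w.IsDY ∧ w.lastExp ≠ 0}) := by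
  rw [mem_Qdy_iff, T, ← MonoidAlgebra.supported_eq_span_single,
    ← MonoidAlgebra.supported_eq_span_single, ← MonoidAlgebra.supported_eq_span_single,
    MonoidAlgebra.mem_supported, MonoidAlgebra.mem_supported, MonoidAlgebra.mem_supported,
    ← Set.subset_inter_iff]
  rfl

theorem Word.lastExp_y_mul (w : Word) : (Word.y * w).lastExp = w.lastExp := by
  rw [Word.y_mul]; simp [Word.lastExp]

theorem Word.lastExp_d_mul {w : Word} (hw : w.IsDY) (h : w.lastExp ≠ 0) :
    (Word.d * w).lastExp ≠ 0 := by
  rcases w with ⟨k, _ | ⟨a, l⟩⟩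
  · have := hw.1
    simp [Word.lastExp, Word.d_mul] at this ⊢
    omega
  · simpa [Word.lastExp, Word.d_mul] using h

theorem Word.lastExp_of_d_mul {w : Word} (h : (Word.d * w).lastExp ≠ 0) :
    w = 1 ∨ w.lastExp ≠ 0 := by
  rcases w with ⟨k, _ | ⟨a, l⟩⟩
  · by_cases hk : k = 0
    · left; rw [hk]; rfl
    · right; simpa [Word.lastExp] using hk
  · right; simpa [Word.lastExp, Word.d_mul] using h

theorem mul_mem_Qdy_inf_T {a x : A} (ha : a = A.d ∨ a = A.y) (hx : x ∈ Qdy ∧ x ∈ T) :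
    a * x ∈ Qdy ∧ a * x ∈ T := by
  rw [mem_Qdy_inf_T_iff] at hx ⊢
  induction hx using Submodule.span_induction with
  | mem x hx =>
    obtain ⟨w, hw, rfl⟩ := hx
    rcases ha with rfl | rfl
    · exact Submodule.subset_span
        ⟨Word.d * w, ⟨Word.isDY_d.mul hw.1, Word.lastExp_d_mul hw.1 hw.2⟩, ofWord_mul _ _⟩
    · refine Submodule.subset_span
        ⟨Word.y * w, ⟨Word.isDY_y.mul hw.1, ?_⟩, ofWord_mul _ _⟩
      rw [Word.lastExp_y_mul]; exact hw.2
  | zero => simp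
  | add x y _ _ hx hy => rw [mul_add]; exact Submodule.add_mem _ hx hy
  | smul r x _ hx => rw [mul_smul_comm]; exact Submodule.smul_mem _ _ hx

theorem shuffleWord_mem_Qdy {u v : Word} (hu : u.IsDY) (hv : v.IsDY) :
    shuffleWord u v ∈ Qdy := by
  have hd : A.d ∈ Qdy := Algebra.subset_adjoin (by simp)
  have hy : A.y ∈ Qdy := Algebra.subset_adjoin (by simp)
  refine hu.induction
    (P := fun u => ∀ v : Word, v.IsDY → shuffleWord u v ∈ Qdy) ?_ ?_ ?_ v hv
  · intro v hv
    rw [shuffleWord_one_left]; exact ofWord_mem_Qdy hv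
  · intro u hu ih v hv
    refine hv.induction (P := fun v => shuffleWord (Word.d * u) v ∈ Qdy) ?_ ?_ ?_
    · rw [shuffleWord_one_right]; exact ofWord_mem_Qdy (Word.isDY_d.mul hu)
    · intro v hv _
      rw [shuffleWord_d_d hu.1 hv.1]
      exact Qdy.sub_mem (Qdy.mul_mem hd (ih _ (Word.isDY_d.mul hv)))
        (ih _ (Word.isDY_d.mul (Word.isDY_d.mul hv)))
    · intro v _ ih'
      rw [shuffleWord_y_right]
      exact Qdy.mul_mem hy ih'
  · intro u _ ih v hv
    rw [shuffleWord_y_left]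
    exact Qdy.mul_mem hy (ih v hv)

theorem shuffleWord_mem_T {u v : Word} (hu : u.IsDY) (hv : v.IsDY)
    (h : u.lastExp ≠ 0 ∨ v.lastExp ≠ 0) :
    shuffleWord u v ∈ Qdy ∧ shuffleWord u v ∈ T := by
  have hw {w : Word} (hw : w.IsDY) (h : w.lastExp ≠ 0) : A.ofWord w ∈ Qdy ∧ A.ofWord w ∈ T :=
    ⟨ofWord_mem_Qdy hw, Submodule.subset_span ⟨w, h, rfl⟩⟩
  have one : (1 : Word).lastExp = 0 := rfl
  refine hu.induction
    (P := fun u => ∀ v : Word, v.IsDY → (u.lastExp ≠ 0 ∨ v.lastExp ≠ 0) →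
      shuffleWord u v ∈ Qdy ∧ shuffleWord u v ∈ T) ?_ ?_ ?_ v hv h
  · intro v hv h
    rw [shuffleWord_one_left]
    exact hw hv (h.resolve_left (by simp [one]))
  · intro u hu ih v hv
    refine hv.induction (P := fun v => ((Word.d * u).lastExp ≠ 0 ∨ v.lastExp ≠ 0) →
      shuffleWord (Word.d * u) v ∈ Qdy ∧ shuffleWord (Word.d * u) v ∈ T) ?_ ?_ ?_
    · intro h
      rw [shuffleWord_one_right]
      exact hw (Word.isDY_d.mul hu) (h.resolve_right (by simp [one]))
    · intro v hv _ h
      by_cases hu1 : u = 1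
      · rw [shuffleWord_d_d hu.1 hv.1, hu1, shuffleWord_one_left, shuffleWord_one_left,
          ← ofWord_mul, sub_self]
        exact ⟨Qdy.zero_mem, T.zero_mem⟩
      · have hv' := Word.isDY_d.mul hv
        have h1 : u.lastExp ≠ 0 ∨ (Word.d * v).lastExp ≠ 0 :=
          h.imp_left fun h => (Word.lastExp_of_d_mul h).resolve_left hu1
        have h2 := mul_mem_Qdy_inf_T (Or.inl rfl) (ih _ hv' h1)
        have h3 := ih _ (Word.isDY_d.mul hv') (h1.imp_right (Word.lastExp_d_mul hv'))
        rw [shuffleWord_d_d hu.1 hv.1]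
        exact ⟨Qdy.sub_mem h2.1 h3.1, T.sub_mem h2.2 h3.2⟩
    · intro v _ ih' h
      rw [Word.lastExp_y_mul] at h
      rw [shuffleWord_y_right]
      exact mul_mem_Qdy_inf_T (Or.inr rfl) (ih' h)
  · intro u _ ih v hv h
    rw [Word.lastExp_y_mul] at h
    rw [shuffleWord_y_left]
    exact mul_mem_Qdy_inf_T (Or.inr rfl) (ih v hv h)

/-- `ℚ⟨d, y⟩` is a subalgebra of `(ℚ⟨d, j, y⟩, ш₀)`. -/
theorem shuffle_mem_Qdy {a b : A} (ha : a ∈ Qdy) (hb : b ∈ Qdy) : shuffle a b ∈ Qdy := by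
  have h := Submodule.apply_mem_map₂ shuffle (mem_Qdy_iff.1 ha) (mem_Qdy_iff.1 hb)
  rw [Submodule.map₂_span_span] at h
  refine (Submodule.span_le (p := Subalgebra.toSubmodule Qdy)).2 ?_ h
  rintro _ ⟨_, ⟨u, hu, rfl⟩, _, ⟨v, hv, rfl⟩, rfl⟩
  change shuffle (A.ofWord u) (A.ofWord v) ∈ Qdy
  rw [shuffle_ofWord]
  exact shuffleWord_mem_Qdy hu hv

theorem shuffle_mem_T {a b : A} (ha : a ∈ Qdy) (hb : b ∈ Qdy) (h : a ∈ T ∨ b ∈ T) :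
    shuffle a b ∈ T := by
  rcases h with h | h
  · have h := Submodule.apply_mem_map₂ shuffle (mem_Qdy_inf_T_iff.1 ⟨ha, h⟩) (mem_Qdy_iff.1 hb)
    rw [Submodule.map₂_span_span] at h
    refine Submodule.span_le.2 ?_ h
    rintro _ ⟨_, ⟨u, hu, rfl⟩, _, ⟨v, hv, rfl⟩, rfl⟩
    change shuffle (A.ofWord u) (A.ofWord v) ∈ T
    rw [shuffle_ofWord]
    exact (shuffleWord_mem_T hu.1 hv (Or.inl hu.2)).2
  · have h := Submodule.apply_mem_map₂ shuffle (mem_Qdy_iff.1 ha) (mem_Qdy_inf_T_iff.1 ⟨hb, h⟩)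
    rw [Submodule.map₂_span_span] at h
    refine Submodule.span_le.2 ?_ h
    rintro _ ⟨_, ⟨u, hu, rfl⟩, _, ⟨v, hv, rfl⟩, rfl⟩
    change shuffle (A.ofWord u) (A.ofWord v) ∈ T
    rw [shuffle_ofWord]
    exact (shuffleWord_mem_T hu hv.1 (Or.inr hv.2)).2

/-- The product `ш₀` on `ℚ⟨d, y⟩`. -/
def Qdy.shuffle : Qdy →ₗ[ℚ] Qdy →ₗ[ℚ] Qdy :=
  LinearMap.mk₂ ℚ (fun a b => ⟨ShuffleZero.shuffle a b, shuffle_mem_Qdy a.2 b.2⟩)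
    (fun _ _ _ => Subtype.ext (by simp)) (fun _ _ _ => Subtype.ext (by simp))
    (fun _ _ _ => Subtype.ext (by simp)) (fun _ _ _ => Subtype.ext (by simp))

/-! ### The algebra `ℋ₋` -/

/-- `𝒯₋ = ℚ⟨d, y⟩ ∩ 𝒯`, as a subspace of `ℚ⟨d, y⟩`. -/
def TMinus : Submodule ℚ Qdy := T.comap Qdy.val.toLinearMap

/-- `ℒ₋ = ℚ⟨d, y⟩ ∩ ℒ`, as a subspace of `ℚ⟨d, y⟩`. -/
def LMinus : Submodule ℚ Qdy := L.comap Qdy.val.toLinearMap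

/-- `ℋ₋ = ℚ⟨d, y⟩ / (𝒯₋ + ℒ₋)`. -/
abbrev HMinus : Type := Qdy ⧸ (TMinus ⊔ LMinus)

theorem Qdy.shuffle_mem_ideal (a b : Qdy) (h : a ∈ TMinus ⊔ LMinus ∨ b ∈ TMinus ⊔ LMinus) :
    Qdy.shuffle a b ∈ TMinus ⊔ LMinus := by
  rcases h with h | h <;> obtain ⟨s, hs, t, ht, rfl⟩ := Submodule.mem_sup.1 h
  · rw [map_add, LinearMap.add_apply]
    exact Submodule.add_mem_sup (shuffle_mem_T s.2 b.2 (Or.inl hs))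
      (isShuffleIdeal_L b t ht).2
  · rw [map_add]
    exact Submodule.add_mem_sup (shuffle_mem_T a.2 s.2 (Or.inr hs))
      (isShuffleIdeal_L a t ht).1

/-- The class in `ℋ₋` of an element of `ℚ⟨d, y⟩`. -/
def HMinus.mk : Qdy →ₗ[ℚ] HMinus := (TMinus ⊔ LMinus).mkQ

/-- The product `ш₀` on `ℋ₋` induced by the one on `ℚ⟨d, y⟩`. -/
def HMinus.shuffle : HMinus →ₗ[ℚ] HMinus →ₗ[ℚ] HMinus :=
  LinearMap.liftQ₂ _ _ (Qdy.shuffle.compr₂ HMinus.mk)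
    (fun a ha => LinearMap.mem_ker.2 <| LinearMap.ext fun b =>
      (Submodule.Quotient.mk_eq_zero _).2 (Qdy.shuffle_mem_ideal a b (Or.inl ha)))
    (fun b hb => LinearMap.mem_ker.2 <| LinearMap.ext fun a =>
      (Submodule.Quotient.mk_eq_zero _).2 (Qdy.shuffle_mem_ideal a b (Or.inr hb)))

theorem HMinus.shuffle_mk (a b : Qdy) :
    HMinus.shuffle (HMinus.mk a) (HMinus.mk b) = HMinus.mk (Qdy.shuffle a b) := rfl

/-- The generators of `ℚ⟨d, y⟩`. -/
def Qdy.d : Qdy := ⟨A.d, Algebra.subset_adjoin (by simp)⟩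
/-- The generators of `ℚ⟨d, y⟩`. -/
def Qdy.y : Qdy := ⟨A.y, Algebra.subset_adjoin (by simp)⟩

/-- The element `d^{k₁} y d^{k₂} y ⋯ d^{kₛ} y` of `ℚ⟨d, y⟩` for a list `k₁, …, kₛ`. -/
def Qdy.word (k : List ℕ) : Qdy := (k.map fun a => Qdy.d ^ a * Qdy.y).prod

end ShuffleZero

end

/-!
Since `y ш₀ w = yw`, the word `d^{k₁} y w` is `d^{k₁} (y ш₀ w)`. Modulo `ℒ`, left multiplication by
`d` obeys the Leibniz rule for `ш₀` on words ending in `y`, so `d^{k₁} (y ш₀ w)` expands by the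
binomial formula into the products `d^i y ш₀ d^j w` with `i + j = k₁`.
-/

namespace ShuffleZero

open Finset

theorem eq_sum_antidiagonal_choose_of_succ {α β M : Type*} [AddCommMonoid M] {f : α → α}
    {g : β → β} {s : Set α} {t : Set β} (hf : Set.MapsTo f s s) (hg : Set.MapsTo g t t)
    {F : ℕ → α → β → M}
    (hF : ∀ n, ∀ a ∈ s, ∀ b ∈ t, F (n + 1) a b = F n (f a) b + F n a (g b))
    (n : ℕ) {a : α} (ha : a ∈ s) {b : β} (hb : b ∈ t) :
    F n a b = ∑ p ∈ antidiagonal n, n.choose p.1 • F 0 (f^[p.1] a) (g^[p.2] b) := by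
  induction n generalizing a b with
  | zero => simp
  | succ n ih =>
    have choose_symm : ∀ p ∈ antidiagonal n, n.choose p.2 = n.choose p.1 := fun p hp =>
      (Nat.choose_symm_of_eq_add (mem_antidiagonal.1 hp).symm).symm
    rw [hF n a ha b hb, ih (hf ha) hb, ih ha (hg hb), add_comm,
      sum_antidiagonal_choose_succ_nsmul fun i j => F 0 (f^[i] a) (g^[j] b)]
    exact congrArg _ (sum_congr rfl fun p hp => by rw [choose_symm p hp]; rfl)

namespace Word

theorem d_pow (n : ℕ) : d ^ n = ⟨-n, []⟩ := by
  induction n with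
  | zero => rfl
  | succ n ih => simp [pow_succ', ih, d_mul]

theorem EndsInY.mul_left (u : Word) {w : Word} (hw : w.EndsInY) : (u * w).EndsInY := by
  rcases u with ⟨k, l⟩
  induction l generalizing k with
  | nil =>
    rcases w with ⟨a, _ | ⟨b, l⟩⟩
    · exact absurd rfl hw.1
    · exact ⟨List.cons_ne_nil _ _, by simpa [lastExp, mul_nil] using hw.2⟩
  | cons a l ih =>
    exact ⟨List.cons_ne_nil _ _, by simpa [lastExp, mul_cons] using (ih a).2⟩

/-- The word `d^{k₁} y d^{k₂} y ⋯ d^{kₛ} y` underlying `Qdy.word [k₁, …, kₛ]`. -/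
def ofDExps (k : List ℕ) : Word := (k.map fun a => d ^ a * y).prod

theorem endsInY_ofDExps {k : List ℕ} (hk : k ≠ []) : (ofDExps k).EndsInY := by
  have endsInY_y : y.EndsInY := ⟨List.cons_ne_nil _ _, rfl⟩
  rw [← List.dropLast_append_getLast hk]
  simpa [ofDExps] using (endsInY_y.mul_left _).mul_left _

end Word

theorem ofWord_pow (w : Word) (n : ℕ) : A.ofWord (w ^ n) = A.ofWord w ^ n :=
  map_pow (MonoidAlgebra.of ℚ Word) w n

theorem shuffle_y_left (a : A) : shuffle A.y a = A.y * a := by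
  have eq_mulLeft : shuffle A.y = LinearMap.mulLeft ℚ A.y :=
    (MonoidAlgebra.basis Word ℚ).ext fun w => by
      rw [MonoidAlgebra.basis_apply, shuffle_ofWord, ← mul_one Word.y, shuffleWord_y_left,
        shuffleWord_one_left, LinearMap.mulLeft_apply]
  exact congrArg (· a) eq_mulLeft

theorem jpow_mul_d_mul_shuffleWord_smodEq (k : ℤ) {u v : Word} (hu : u.EndsInY)
    (hv : v.EndsInY) :
    A.jpow k * (A.d * shuffleWord u v) ≡
      A.jpow k * shuffleWord (Word.d * u) v + A.jpow k * shuffleWord u (Word.d * v)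
      [SMOD L] := by
  refine SModEq.sub_mem.2 (Submodule.mem_sInf.2 fun I hI => hI.2 ⟨k, u, v, hu, hv, ?_⟩)
  simp only [← ofWord_mul, shuffle_ofWord]
  noncomm_ring

-- `L` is an ideal for `ш₀` only and `d * ·` has no reason to preserve it, so applying `d` to the
-- case `n` does not give the case `n + 1`; the factors `j^k` in the generators of `L` do.
theorem d_pow_mul_shuffleWord_smodEq (n : ℕ) {u v : Word} (hu : u.EndsInY) (hv : v.EndsInY) :
    A.d ^ n * shuffleWord u v ≡
      ∑ p ∈ antidiagonal n,
        n.choose p.1 • shuffleWord (Word.d ^ p.1 * u) (Word.d ^ p.2 * v) [SMOD L] := by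
  have d_mul_mem : Set.MapsTo (Word.d * ·) {w : Word | w.EndsInY} {w | w.EndsInY} :=
    fun _ hw => hw.mul_left _
  have leibniz : ∀ n : ℕ, ∀ u ∈ {w : Word | w.EndsInY}, ∀ v ∈ {w : Word | w.EndsInY},
      L.mkQ (A.d ^ (n + 1) * shuffleWord u v) =
        L.mkQ (A.d ^ n * shuffleWord (Word.d * u) v) +
          L.mkQ (A.d ^ n * shuffleWord u (Word.d * v)) := fun n u hu v hv => by
    rw [pow_succ, mul_assoc, ← ofWord_pow, Word.d_pow, ← map_add]
    exact jpow_mul_d_mul_shuffleWord_smodEq _ hu hv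
  have expansion := eq_sum_antidiagonal_choose_of_succ d_mul_mem d_mul_mem
    (F := fun n u v => L.mkQ (A.d ^ n * shuffleWord u v)) leibniz n hu hv
  simp only [mul_left_iterate, pow_zero, one_mul, ← map_nsmul, ← map_sum] at expansion
  exact expansion

namespace Qdy

theorem coe_word (k : List ℕ) : (word k : A) = A.ofWord (Word.ofDExps k) := by
  induction k with
  | nil => rfl
  | cons a k ih =>
    simp only [Word.ofDExps, word, List.map_cons, List.prod_cons] at ih ⊢
    rw [ofWord_mul, ofWord_mul, ofWord_pow, ← ih]
    rfl

theorem word_cons (n : ℕ) (k : List ℕ) : word (n :: k) = d ^ n * (y * word k) := by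
  simp [word, mul_assoc]

theorem word_singleton_zero : word [0] = y := by simp [word]

theorem shuffle_y_left (a : Qdy) : Qdy.shuffle y a = y * a :=
  Subtype.ext (ShuffleZero.shuffle_y_left a)

end Qdy

namespace HMinus

theorem mk_eq_mk_of_smodEq {a b : Qdy} (h : (a : A) ≡ b [SMOD L]) : mk a = mk b :=
  SModEq.mono (U₁ := LMinus) le_sup_right (SModEq.comap (f := Qdy.val.toLinearMap) (V := L) h)

theorem mk_d_pow_mul_shuffle_word (n : ℕ) {k l : List ℕ} (hk : k ≠ []) (hl : l ≠ []) :
    mk (Qdy.d ^ n * Qdy.shuffle (Qdy.word k) (Qdy.word l)) =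
      ∑ p ∈ antidiagonal n, (n.choose p.1 : ℚ) •
        shuffle (mk (Qdy.d ^ p.1 * Qdy.word k)) (mk (Qdy.d ^ p.2 * Qdy.word l)) := by
  have coe_shuffle (a b : Qdy) : (Qdy.shuffle a b : A) = ShuffleZero.shuffle a b := rfl
  have coe_d : (Qdy.d : A) = A.d := rfl
  simp only [shuffle_mk, Nat.cast_smul_eq_nsmul, ← map_nsmul mk, ← map_sum mk]
  refine mk_eq_mk_of_smodEq ?_
  simpa only [MulMemClass.coe_mul, SubmonoidClass.coe_pow, AddSubmonoidClass.coe_finsetSum,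
    AddSubmonoidClass.coe_nsmul, coe_shuffle, coe_d, Qdy.coe_word, ← ofWord_pow, ← ofWord_mul,
    shuffle_ofWord] using
    d_pow_mul_shuffleWord_smodEq n (Word.endsInY_ofDExps hk) (Word.endsInY_ofDExps hl)

end HMinus

end ShuffleZero

open ShuffleZero in
theorem mainTheorem8 (r : ℕ) (hr : 2 ≤ r) (k : Fin r → ℕ) :
    HMinus.mk (Qdy.word (List.ofFn k)) =
      ∑ p ∈ Finset.HasAntidiagonal.antidiagonal (k ⟨0, by omega⟩),
        ((k ⟨0, by omega⟩).choose p.1 : ℚ) •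
          HMinus.shuffle (HMinus.mk (Qdy.d ^ p.1 * Qdy.y))
            (HMinus.mk (Qdy.d ^ p.2 * Qdy.word (List.ofFn k).tail)) := by
  obtain ⟨s, rfl⟩ : ∃ s, r = s + 2 := ⟨r - 2, by omega⟩
  rw [List.ofFn_succ, List.tail_cons, Qdy.word_cons, ← Qdy.shuffle_y_left,
    ← Qdy.word_singleton_zero]
  exact HMinus.mk_d_pow_mul_shuffle_word _ (List.cons_ne_nil _ _) (by simp)
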